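/- Let $Y=[0,2\pi)^d$ and $Y'=[-\tfrac12,\tfrac12)^d$, and let $A=(a_{jk})_{j,k=1}^d$ be a matrix of real, bounded, measurable functions on $\mathbb{R}^d$ that is $Y$-periodic ($A(y+2\pi p)=A(y)$ for all $p\in\mathbb{Z}^d$ and a.e. $y$), symmetric, and elliptic: there is $\alpha>0$ with $A(y)\xi\cdot\xi\ge\alpha|\xi|^2$ for all $\xi\in\mathbb{R}^d$ and a.e. $y$. Let $L^2_\sharp(Y)$ be the space of complex-valued $Y$-periodic functions that are square integrable over $Y$, and let $H^2_\sharp(Y)$ be the space of those $u\in L^2_\sharp(Y)$ whose Fourier coefficients $\hat u(n)$ satisfy $\|u\|_{H^2}^2=\sum_{n\in\mathbb{Z}^d}(1+|n|^2)^2|\hat u(n)|^2<\infty$. For $\rho>0$ and $\eta\in\mathbb{R}^d$ let $\mathcal{A}^\rho(\eta)=\rho^2(\nabla+i\eta)^4-(\nabla+i\eta)\cdot A(y)(\nabla+i\eta)$ be the operator associated with the form $$a^\rho[\eta](u,v)=\int_Y A(\nabla+i\eta)u\cdot\overline{(\nabla+i\eta)v}\,dy+\rho^2\int_Y(\nabla+i\eta)^2u\,\overline{(\nabla+i\eta)^2v}\,dy,\qquad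 u,v\in H^2_\sharp(Y).$$ Thus $\phi$ is an eigenfunction of $\mathcal{A}^\rho(\eta)$ for the eigenvalue $\lambda$ if $0\ne\phi\in H^2_\sharp(Y)$ and $a^\rho[\eta](\phi,v)=\lambda\int_Y\phi\,\overline{v}\,dy$ for all $v\in H^2_\sharp(Y)$. The eigenvalues are real, and the first Bloch eigenvalue $\lambda_1^\rho(\eta)$ is the smallest one. **Theorem.** For every $\rho>0$ there exist $\delta_\rho>0$ and a ball $U^\rho=\{\eta\in\mathbb{R}^d:|\eta|<\delta_\rho\}\subseteq Y'$ such that 1. for every $\eta\in U^\rho$ the operator $\mathcal{A}^\rho(\eta)$ has a smallest eigenvalue $\lambda_1^\rho(\eta)$, and $\eta\mapsto\lambda_1^\rho(\eta)$ is (real) analytic on $U^\rho$; 2. there is a choice of corresponding eigenfunctions $\phi_1^\rho(\cdot,\eta)$, $\eta\in U^\rho$, such that $\eta\mapsto\phi_1^\rho(\cdot,\eta)\in H^2_\sharp(Y)$ is analytic on $U^\rho$. -/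

import Mathlib

open MeasureTheory Set
open scoped Real ENNReal ComplexConjugate

noncomputable section

namespace BlochWave

/-! ### The periodicity cell and `L²` of periodic functions -/

/-- The basic periodicity cell `Y = [0, 2π)^d`. -/
def cell (d : ℕ) : Set (Fin d → ℝ) := Set.univ.pi fun _ => Ico 0 (2 * π)

/-- Lebesgue measure on the periodicity cell. -/
def cellMeasure (d : ℕ) : Measure (Fin d → ℝ) := volume.restrict (cell d)

/-- The dual cell `Y' = [-1/2, 1/2)^d`. -/
def dualCell (d : ℕ) : Set (EuclideanSpace ℝ (Fin d)) :=
  {η | ∀ j, η j ∈ Ico (-(1 / 2) : ℝ) (1 / 2)}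

/-- The space `L²_♯(Y)` of complex valued periodic functions that are square integrable over a
period; such a function is determined by its restriction to `Y`. -/
abbrev L2 (d : ℕ) : Type := Lp ℂ 2 (cellMeasure d)

/-- The exponential `y ↦ (2π)^{-d/2} exp(i n·y)`, for a frequency `n ∈ ℤ^d`, written as a product
over the coordinates. -/
def expFun {d : ℕ} (n : Fin d → ℤ) (y : Fin d → ℝ) : ℂ :=
  ∏ j, ((√(2 * π) : ℂ)⁻¹ * Complex.exp (Complex.I * n j * y j))

theorem cellMeasure_eq_pi (d : ℕ) :
    cellMeasure d = Measure.pi fun _ : Fin d => (volume : Measure ℝ).restrict (Ico 0 (2 * π)) :=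
  Measure.restrict_pi_pi _ _

instance (d : ℕ) : IsFiniteMeasure (cellMeasure d) := by
  rw [cellMeasure_eq_pi]; infer_instance

theorem continuous_expFun {d : ℕ} (n : Fin d → ℤ) : Continuous (expFun n) := by
  unfold expFun; fun_prop

theorem norm_expFun {d : ℕ} (n : Fin d → ℤ) (y : Fin d → ℝ) :
    ‖expFun n y‖ = (√(2 * π))⁻¹ ^ d := by
  have h : ∀ j : Fin d, ‖Complex.exp (Complex.I * n j * y j)‖ = 1 := by
    intro j
    have := Complex.norm_exp_ofReal_mul_I ((n j : ℝ) * y j)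
    rw [← this]; congr 2; push_cast; ring
  simp [expFun, norm_prod, h, abs_of_nonneg (Real.sqrt_nonneg _)]

theorem memLp_expFun {d : ℕ} (n : Fin d → ℤ) : MemLp (expFun n) 2 (cellMeasure d) :=
  MemLp.of_bound (continuous_expFun n).aestronglyMeasurable ((√(2 * π))⁻¹ ^ d)
    (Filter.Eventually.of_forall fun y => (norm_expFun n y).le)

/-- The normalized exponential of frequency `n` as an element of `L²_♯(Y)`. -/
def expL2 {d : ℕ} (n : Fin d → ℤ) : L2 d := (memLp_expFun n).toLp _

theorem integral_exp_cell (k : ℤ) :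
    ∫ t : ℝ in Ico 0 (2 * π), Complex.exp (Complex.I * k * t) = if k = 0 then (2 * π : ℂ) else 0 := by
  rw [integral_Ico_eq_integral_Ioc, ← intervalIntegral.integral_of_le (by positivity)]
  split_ifs with hk
  · subst hk; simp
  · have hc : Complex.I * (k : ℂ) ≠ 0 := by simp [hk]
    rw [integral_exp_mul_complex hc]
    have : Complex.exp (Complex.I * k * ((2 * π : ℝ) : ℂ)) = 1 := by
      rw [← Complex.exp_int_mul_two_pi_mul_I k]; congr 1; push_cast; ring
    rw [this]; simp

theorem orthonormal_expL2 (d : ℕ) : Orthonormal ℂ (expL2 (d := d)) := by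
  rw [orthonormal_iff_ite]
  intro m n
  have h1 : inner ℂ (expL2 m) (expL2 n) = ∫ y, conj (expFun m y) * expFun n y ∂(cellMeasure d) := by
    rw [L2.inner_def]
    apply integral_congr_ae
    filter_upwards [(memLp_expFun m).coeFn_toLp, (memLp_expFun n).coeFn_toLp] with y h1 h2
    simp only [expL2, h1, h2, RCLike.inner_apply]
    ring
  have hs : ((√(2 * π) : ℂ)⁻¹ * (√(2 * π) : ℂ)⁻¹) * (2 * π) = 1 := by
    have h0 : (√(2 * π)) ≠ 0 := by positivity
    have h2 : (√(2 * π)) * (√(2 * π)) = 2 * π := Real.mul_self_sqrt (by positivity)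
    have h3 : ((√(2 * π))⁻¹ * (√(2 * π))⁻¹) * (2 * π) = 1 := by
      nth_rewrite 3 [← h2]; field_simp
    exact_mod_cast h3
  have h2 : ∀ y : Fin d → ℝ, conj (expFun m y) * expFun n y
      = ∏ j, ((√(2 * π) : ℂ)⁻¹ * (√(2 * π) : ℂ)⁻¹) *
        Complex.exp (Complex.I * (n j - m j : ℤ) * y j) := by
    intro y
    simp only [expFun, map_prod, ← Finset.prod_mul_distrib]
    refine Finset.prod_congr rfl fun j _ => ?_
    rw [map_mul, ← Complex.exp_conj]
    simp only [map_mul, map_inv₀, Complex.conj_ofReal, Complex.conj_I, map_intCast]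
    rw [mul_mul_mul_comm, ← Complex.exp_add]
    congr 2; push_cast; ring
  rw [h1]
  simp_rw [h2]
  rw [cellMeasure_eq_pi]
  rw [integral_fintype_prod_eq_prod (μ := fun _ : Fin d => (volume : Measure ℝ).restrict (Ico 0 (2 * π)))
    (fun (j : Fin d) (t : ℝ) => ((√(2 * π) : ℂ)⁻¹ * (√(2 * π) : ℂ)⁻¹) *
        Complex.exp (Complex.I * (n j - m j : ℤ) * t))]
  simp_rw [integral_const_mul, integral_exp_cell]
  split_ifs with h
  · subst h
    simp only [sub_self, if_true, hs, Finset.prod_const_one]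
  · obtain ⟨j, hj⟩ := Function.ne_iff.mp h
    refine Finset.prod_eq_zero (Finset.mem_univ j) ?_
    rw [if_neg (by omega), mul_zero]

/-- Auxiliary parametrization of the interval by the unit circle. -/
def circleLift (x : UnitAddCircle) : ℝ := 2 * π * (AddCircle.equivIoc 1 0 x : ℝ)

theorem measurable_circleLift : Measurable circleLift :=
  (measurable_subtype_coe.comp (AddCircle.measurableEquivIoc 1 0).measurable).const_mul _

theorem coe_circleLift (x : UnitAddCircle) : (((2 * π)⁻¹ * circleLift x : ℝ) : UnitAddCircle) = x := by
  have : (2 * π)⁻¹ * circleLift x = (AddCircle.equivIoc 1 0 x : ℝ) := by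
    unfold circleLift; field_simp
  rw [this]
  exact (AddCircle.equivIoc (1 : ℝ) 0).symm_apply_apply x

theorem measurePreserving_circleLift :
    MeasurePreserving circleLift (AddCircle.haarAddCircle : Measure UnitAddCircle)
      (ENNReal.ofReal (2 * π)⁻¹ • (volume : Measure ℝ).restrict (Ico 0 (2 * π))) := by
  refine ⟨measurable_circleLift, ?_⟩
  have hh : (AddCircle.haarAddCircle : Measure UnitAddCircle) = (volume : Measure (AddCircle (1 : ℝ))) := by
    rw [AddCircle.volume_eq_smul_haarAddCircle]; simp
  rw [hh, ← (AddCircle.measurePreserving_mk 1 0).map_eq,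
    Measure.map_map measurable_circleLift AddCircle.measurable_mk']
  have hcongr : (circleLift ∘ (QuotientAddGroup.mk : ℝ → AddCircle (1 : ℝ)))
      =ᵐ[volume.restrict (Ioc (0 : ℝ) (0 + 1))] fun t => 2 * π * t := by
    filter_upwards [ae_restrict_mem measurableSet_Ioc] with t ht
    have h : (AddCircle.equivIoc 1 0 (t : AddCircle (1 : ℝ)) : ℝ) = t :=
      congrArg Subtype.val ((AddCircle.equivIoc (1 : ℝ) 0).apply_symm_apply ⟨t, ht⟩)
    simp only [Function.comp, circleLift]
    exact congrArg (fun s => 2 * π * s) h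
  rw [Measure.map_congr hcongr]
  have hpi : (2 * π) ≠ 0 := by positivity
  have hemb : MeasurableEmbedding fun t : ℝ => 2 * π * t :=
    (Homeomorph.mulLeft₀ (2 * π) hpi).measurableEmbedding
  have hpre : (fun t : ℝ => 2 * π * t) ⁻¹' (Ioc 0 (2 * π)) = Ioc 0 (0 + 1) := by
    ext t
    have : (0 : ℝ) < 2 * π := by positivity
    simp only [mem_preimage, mem_Ioc, zero_add]
    constructor
    · rintro ⟨h1, h2⟩; exact ⟨pos_of_mul_pos_right h1 this.le |>.trans_le le_rfl, by nlinarith⟩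
    · rintro ⟨h1, h2⟩; exact ⟨by positivity, by nlinarith⟩
  rw [← hpre, ← hemb.restrict_map, Real.map_volume_mul_left hpi, Measure.restrict_smul,
    abs_of_pos (by positivity), Measure.restrict_congr_set Ico_ae_eq_Ioc]

/-- Auxiliary parametrization of the cell by the unit torus. -/
def torusLift {d : ℕ} (x : UnitAddTorus (Fin d)) : Fin d → ℝ := fun j => circleLift (x j)

theorem measurePreserving_torusLift (d : ℕ) :
    MeasurePreserving (torusLift (d := d))
      (Measure.pi fun _ => (AddCircle.haarAddCircle : Measure UnitAddCircle))
      (ENNReal.ofReal (2 * π)⁻¹ ^ d • cellMeasure d) := by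
  have h := measurePreserving_pi
    (fun _ : Fin d => (AddCircle.haarAddCircle : Measure UnitAddCircle))
    (fun _ : Fin d => ENNReal.ofReal (2 * π)⁻¹ • (volume : Measure ℝ).restrict (Ico 0 (2 * π)))
    (hν := fun _ => by
      have : IsFiniteMeasure (ENNReal.ofReal (2 * π)⁻¹ •
        (volume : Measure ℝ).restrict (Ico 0 (2 * π))) := Measure.smul_finite _ ENNReal.ofReal_ne_top
      infer_instance)
    (fun _ => measurePreserving_circleLift)
  have he : (Measure.pi fun _ : Fin d =>
      ENNReal.ofReal (2 * π)⁻¹ • (volume : Measure ℝ).restrict (Ico 0 (2 * π)))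
      = ENNReal.ofReal (2 * π)⁻¹ ^ d • cellMeasure d := by
    have : IsFiniteMeasure (ENNReal.ofReal (2 * π)⁻¹ •
        (volume : Measure ℝ).restrict (Ico 0 (2 * π))) := Measure.smul_finite _ ENNReal.ofReal_ne_top
    refine Measure.pi_eq fun s _ => ?_
    rw [cellMeasure_eq_pi, Measure.smul_apply, Measure.pi_pi]
    simp [Finset.prod_mul_distrib]
  rw [he] at h
  exact h

theorem mFourier_eq_expFun {d : ℕ} (n : Fin d → ℤ) (x : UnitAddTorus (Fin d)) :
    UnitAddTorus.mFourier (-n) x = (√(2 * π) : ℂ) ^ d * conj (expFun n (torusLift x)) := by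
  have h0 : (√(2 * π) : ℂ) ≠ 0 := by
    have : (√(2 * π)) ≠ 0 := by positivity
    exact_mod_cast this
  have hx : ∀ j, x j = (((2 * π)⁻¹ * torusLift x j : ℝ) : UnitAddCircle) :=
    fun j => (coe_circleLift (x j)).symm
  have hc : (√(2 * π) : ℂ) ^ d = ∏ _j : Fin d, (√(2 * π) : ℂ) := by simp
  simp only [UnitAddTorus.mFourier, ContinuousMap.coe_mk, expFun, map_prod, hc,
    ← Finset.prod_mul_distrib]
  refine Finset.prod_congr rfl fun j _ => ?_
  rw [hx j, fourier_coe_apply, map_mul, ← Complex.exp_conj]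
  simp only [map_mul, map_inv₀, Complex.conj_ofReal, Complex.conj_I, map_intCast]
  rw [mul_inv_cancel_left₀ h0]
  congr 1
  have : (π : ℂ) ≠ 0 := by exact_mod_cast Real.pi_ne_zero
  simp only [Pi.neg_apply]
  push_cast
  field_simp

theorem expL2_orthogonal_eq_bot (d : ℕ) :
    (Submodule.span ℂ (Set.range (expL2 (d := d))))ᗮ = ⊥ := by
  rw [Submodule.eq_bot_iff]
  intro u hu
  have hz : ∀ n, ∫ y, conj (expFun n y) * u y ∂(cellMeasure d) = 0 := by
    intro n
    have h := Submodule.inner_right_of_mem_orthogonal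
      (Submodule.subset_span (Set.mem_range_self n)) hu
    rw [← h, L2.inner_def]
    apply integral_congr_ae
    filter_upwards [(memLp_expFun n).coeFn_toLp] with y h1
    simp only [expL2, h1, RCLike.inner_apply]
    ring
  set c : ℝ≥0∞ := ENNReal.ofReal (2 * π)⁻¹ ^ d with hc
  have hc0 : c ≠ 0 := by
    have : (0 : ℝ) < (2 * π)⁻¹ := by positivity
    simp only [hc]; exact pow_ne_zero _ (by simpa using this)
  have hct : c ≠ ∞ := ENNReal.pow_ne_top ENNReal.ofReal_ne_top
  have hmp := measurePreserving_torusLift d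
  have hu2 : MemLp u 2 (c • cellMeasure d) := (Lp.memLp u).smul_measure hct
  have hw := hu2.comp_measurePreserving hmp
  set w := hw.toLp with hwdef
  have hw0 : w = 0 := by
    have hcoef : ∀ n, UnitAddTorus.mFourierBasis.repr w n = 0 := by
      intro n
      rw [UnitAddTorus.mFourierBasis_repr, UnitAddTorus.mFourierCoeff]
      have e1 : ∫ x, UnitAddTorus.mFourier (-n) x • w x
            ∂(Measure.pi fun _ => (AddCircle.haarAddCircle : Measure UnitAddCircle))
          = ∫ x, (fun y => (√(2 * π) : ℂ) ^ d * (conj (expFun n y) * u y)) (torusLift x)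
            ∂(Measure.pi fun _ => (AddCircle.haarAddCircle : Measure UnitAddCircle)) := by
        apply integral_congr_ae
        filter_upwards [hw.coeFn_toLp] with x hx
        rw [hwdef, hx, mFourier_eq_expFun, smul_eq_mul, Function.comp]
        ring
      refine e1.trans ?_
      have hmeas : AEStronglyMeasurable
          (fun y => (√(2 * π) : ℂ) ^ d * (conj (expFun n y) * u y)) (c • cellMeasure d) := by
        refine AEStronglyMeasurable.smul_measure ?_ c
        refine AEStronglyMeasurable.const_mul ?_ _
        refine AEStronglyMeasurable.mul ?_ (Lp.aestronglyMeasurable u)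
        exact (Complex.continuous_conj.comp (continuous_expFun n)).aestronglyMeasurable
      have e2 := integral_map hmp.measurable.aemeasurable
        (f := fun y => (√(2 * π) : ℂ) ^ d * (conj (expFun n y) * u y))
        (by rw [hmp.map_eq]; exact hmeas)
      rw [← e2, hmp.map_eq, integral_smul_measure, integral_const_mul, hz n]
      simp
    have : UnitAddTorus.mFourierBasis.repr w = 0 := by
      ext n; simpa using hcoef n
    simpa using this
  have hu0 : ∀ᵐ y ∂(c • cellMeasure d), u y = 0 := by
    have h1 : (u ∘ torusLift) =ᵐ[Measure.pi fun _ => (AddCircle.haarAddCircle : Measure UnitAddCircle)] 0 := by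
      have h2 := hw.coeFn_toLp
      rw [← hwdef, hw0] at h2
      exact h2.symm.trans (Lp.coeFn_zero _ _ _)
    rw [← hmp.map_eq]
    have hmu : AEMeasurable u (c • cellMeasure d) := hu2.aestronglyMeasurable.aemeasurable
    rw [← hmp.map_eq] at hmu
    rw [ae_map_iff hmp.measurable.aemeasurable]
    · exact h1
    · exact (Lp.stronglyMeasurable u).measurable (measurableSet_singleton 0)
  rw [Measure.ae_ennreal_smul_measure_eq hc0] at hu0
  exact (Lp.eq_zero_iff_ae_eq_zero).mpr hu0

/-- The normalized exponentials form a Hilbert basis of `L²_♯(Y)`. For `u ∈ L²_♯(Y)`,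
`expBasis d |>.repr u n` is the `n`-th Fourier coefficient
`û(n) = (2π)^{-d/2} ∫_Y u(y) exp(-i n·y) dy`. -/
def expBasis (d : ℕ) : HilbertBasis (Fin d → ℤ) ℂ (L2 d) :=
  HilbertBasis.mkOfOrthogonalEqBot (orthonormal_expL2 d) (expL2_orthogonal_eq_bot d)

theorem coe_expBasis (d : ℕ) : ⇑(expBasis d) = expL2 :=
  HilbertBasis.coe_mkOfOrthogonalEqBot _ _

theorem expBasis_repr {d : ℕ} (u : L2 d) (n : Fin d → ℤ) :
    (expBasis d).repr u n = ∫ y, conj (expFun n y) * u y ∂(cellMeasure d) := by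
  rw [HilbertBasis.repr_apply_apply, coe_expBasis, L2.inner_def]
  apply integral_congr_ae
  filter_upwards [(memLp_expFun n).coeFn_toLp] with y h1
  simp only [expL2, h1, RCLike.inner_apply]
  ring

/-! ### The periodic Sobolev space `H²_♯(Y)` -/

/-- `|n|²` for a frequency `n ∈ ℤ^d`. -/
def freqSq {d : ℕ} (n : Fin d → ℤ) : ℝ := ∑ j, (n j : ℝ) ^ 2

/-- The Sobolev weight `1 + |n|²`. -/
def weight {d : ℕ} (n : Fin d → ℤ) : ℝ := 1 + freqSq n

theorem freqSq_nonneg {d : ℕ} (n : Fin d → ℤ) : 0 ≤ freqSq n :=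
  Finset.sum_nonneg fun _ _ => sq_nonneg _

theorem weight_pos {d : ℕ} (n : Fin d → ℤ) : 0 < weight n := by
  have := freqSq_nonneg n
  unfold weight; linarith

/-- The periodic functions `u` with `∑ (1 + |n|²)² |û(n)|² < ∞`, as a subspace of `L²_♯(Y)`. -/
def H2Submodule (d : ℕ) : Submodule ℂ (L2 d) where
  carrier := {u | Memℓp (fun n => (weight n : ℂ) * (expBasis d).repr u n) 2}
  zero_mem' := by
    refine (congrArg (fun f => Memℓp f 2) ?_).mp (zero_memℓp : Memℓp (0 : (Fin d → ℤ) → ℂ) 2)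
    funext n
    simp
  add_mem' := by
    intro u v hu hv
    have h := Memℓp.add hu hv
    refine (congrArg (fun f => Memℓp f 2) ?_).mp h
    funext n
    simp [mul_add]
  smul_mem' := by
    intro c u hu
    have h := Memℓp.const_smul hu c
    refine (congrArg (fun f => Memℓp f 2) ?_).mp h
    funext n
    simp only [Pi.smul_apply, smul_eq_mul, map_smul, lp.coeFn_smul]
    ring

/-- The Sobolev space `H²_♯(Y)`. It is a type of its own, because its norm is the Sobolev norm and
not the one inherited from `L²_♯(Y)`. -/
def H2 (d : ℕ) : Type := H2Submodule d

namespace H2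

variable {d : ℕ}

instance : AddCommGroup (H2 d) := inferInstanceAs (AddCommGroup (H2Submodule d))
instance : Module ℂ (H2 d) := inferInstanceAs (Module ℂ (H2Submodule d))

/-- The inclusion of `H²_♯(Y)` in `L²_♯(Y)`. -/
def toL2 : H2 d →ₗ[ℂ] L2 d := (H2Submodule d).subtype

theorem toL2_injective : Function.Injective (toL2 (d := d)) := Subtype.val_injective

/-- The linear map `u ↦ ((1 + |n|²) û(n))_n` from `H²_♯(Y)` to `ℓ²(ℤ^d)`. -/
def weighted : H2 d →ₗ[ℂ] lp (fun _ : Fin d → ℤ => ℂ) 2 where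
  toFun u := ⟨fun n => (weight n : ℂ) * (expBasis d).repr (toL2 u) n, u.2⟩
  map_add' u v := by
    ext n
    simp only [map_add, lp.coeFn_add, Pi.add_apply, mul_add]
    try rfl
  map_smul' c u := by
    ext n
    simp only [map_smul, lp.coeFn_smul, Pi.smul_apply, smul_eq_mul, RingHom.id_apply]
    ring

theorem weighted_apply (u : H2 d) (n : Fin d → ℤ) :
    weighted u n = (weight n : ℂ) * (expBasis d).repr (toL2 u) n := rfl

theorem weighted_injective : Function.Injective (weighted (d := d)) := by
  intro u v h
  apply toL2_injective
  apply (expBasis d).repr.injective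
  ext n
  have hn : weighted u n = weighted v n := by rw [h]
  rw [weighted_apply, weighted_apply] at hn
  exact mul_left_cancel₀ (by exact_mod_cast (weight_pos n).ne') hn

instance : NormedAddCommGroup (H2 d) :=
  NormedAddCommGroup.induced (H2 d) (lp (fun _ : Fin d → ℤ => ℂ) 2) weighted weighted_injective

instance : InnerProductSpace ℂ (H2 d) := InnerProductSpace.induced weighted

/-- The norm of `H²_♯(Y)` is `(∑ (1 + |n|²)² |û(n)|²)^{1/2}`. -/
theorem hasSum_norm_sq (u : H2 d) :
    HasSum (fun n => weight n ^ 2 * ‖(expBasis d).repr (toL2 u) n‖ ^ 2) (‖u‖ ^ 2) := by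
  have h := lp.hasSum_norm (p := 2) (by norm_num) (weighted u)
  have hu : ‖weighted u‖ = ‖u‖ := rfl
  rw [hu] at h
  simpa [weighted_apply, mul_pow] using h

theorem memℓp_mul (u : H2 d) (m : (Fin d → ℤ) → ℂ) (hm : ∀ n, ‖m n‖ ≤ weight n) :
    Memℓp (fun n => m n * (expBasis d).repr (toL2 u) n) 2 := by
  have h2 : 0 < (2 : ℝ≥0∞).toReal := by norm_num
  have h := (memℓp_gen_iff h2).mp (lp.memℓp (weighted u))
  refine (memℓp_gen_iff h2).mpr (h.of_nonneg_of_le (fun n => by positivity) fun n => ?_)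
  refine Real.rpow_le_rpow (norm_nonneg _) ?_ h2.le
  rw [weighted_apply, norm_mul, norm_mul, Complex.norm_real, Real.norm_of_nonneg (weight_pos n).le]
  exact mul_le_mul_of_nonneg_right (hm n) (norm_nonneg _)

/-- The Fourier multiplier with symbol `m`: the function whose Fourier coefficients are
`m(n) û(n)`. -/
def multiplier (m : (Fin d → ℤ) → ℂ) (hm : ∀ n, ‖m n‖ ≤ weight n) : H2 d →ₗ[ℂ] L2 d where
  toFun u := (expBasis d).repr.symm ⟨fun n => m n * (expBasis d).repr (toL2 u) n, memℓp_mul u m hm⟩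
  map_add' u v := by
    rw [← map_add]
    congr 1
    ext n
    simp only [map_add, lp.coeFn_add, Pi.add_apply, mul_add]
    try rfl
  map_smul' c u := by
    rw [RingHom.id_apply, ← map_smul]
    congr 1
    ext n
    simp only [map_smul, lp.coeFn_smul, Pi.smul_apply, smul_eq_mul]
    ring

theorem repr_multiplier (m : (Fin d → ℤ) → ℂ) (hm : ∀ n, ‖m n‖ ≤ weight n) (u : H2 d)
    (n : Fin d → ℤ) :
    (expBasis d).repr (multiplier m hm u) n = m n * (expBasis d).repr (toL2 u) n := by
  simp [multiplier]

theorem norm_symbol_deriv_le (j : Fin d) (n : Fin d → ℤ) :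
    ‖Complex.I * (n j : ℂ)‖ ≤ weight n := by
  have h1 : (n j : ℝ) ^ 2 ≤ freqSq n :=
    Finset.single_le_sum (f := fun j => (n j : ℝ) ^ 2) (fun _ _ => sq_nonneg _) (Finset.mem_univ j)
  have h2 : |(n j : ℝ)| ^ 2 = (n j : ℝ) ^ 2 := sq_abs _
  rw [norm_mul, Complex.norm_I, one_mul, Complex.norm_intCast]
  unfold weight
  nlinarith [sq_nonneg (|(n j : ℝ)| - 1), abs_nonneg (n j : ℝ)]

theorem norm_symbol_laplacian_le (n : Fin d → ℤ) : ‖(-(freqSq n : ℝ) : ℂ)‖ ≤ weight n := by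
  rw [norm_neg, Complex.norm_real, Real.norm_of_nonneg (freqSq_nonneg n)]
  unfold weight
  linarith

/-- The partial derivative `∂u/∂y_j` of `u ∈ H²_♯(Y)` in the sense of periodic distributions; its
Fourier coefficients are `i n_j û(n)`. -/
def deriv (j : Fin d) : H2 d →ₗ[ℂ] L2 d :=
  multiplier (fun n => Complex.I * (n j : ℂ)) (norm_symbol_deriv_le j)

/-- The Laplacian `Δu` of `u ∈ H²_♯(Y)` in the sense of periodic distributions; its Fourier
coefficients are `-|n|² û(n)`. -/
def laplacian : H2 d →ₗ[ℂ] L2 d :=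
  multiplier (fun n => (-(freqSq n : ℝ) : ℂ)) norm_symbol_laplacian_le

/-- The `j`-th component `∂_j u + i η_j u` of the shifted gradient `(∇ + iη)u`. -/
def shiftedDeriv (η : EuclideanSpace ℝ (Fin d)) (j : Fin d) (u : H2 d) : L2 d :=
  deriv j u + (Complex.I * (η j : ℂ)) • toL2 u

/-- The shifted Laplacian `(∇ + iη)²u = Δu + 2i η·∇u - |η|² u`. -/
def shiftedLaplacian (η : EuclideanSpace ℝ (Fin d)) (u : H2 d) : L2 d :=
  laplacian u + (2 * Complex.I) • (∑ j, (η j : ℂ) • deriv j u) - ((‖η‖ ^ 2 : ℝ) : ℂ) • toL2 u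

end H2

/-! ### The Bloch eigenvalue problem -/

/-- The standing assumptions on the coefficient matrix `A`: its entries are real, bounded and
(Lebesgue) measurable functions on `ℝ^d`, and it is uniformly elliptic, `Y`-periodic and
symmetric. -/
structure IsCoefficientMatrix {d : ℕ} (A : (Fin d → ℝ) → Matrix (Fin d) (Fin d) ℝ) : Prop where
  measurable : ∀ j k, AEMeasurable (fun y => A y j k)
  bounded : ∃ M : ℝ, ∀ᵐ y, ∀ j k, |A y j k| ≤ M
  elliptic : ∃ α : ℝ, 0 < α ∧ ∀ᵐ y, ∀ ξ : Fin d → ℝ, α * (ξ ⬝ᵥ ξ) ≤ (A y).mulVec ξ ⬝ᵥ ξ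
  periodic : ∀ p : Fin d → ℤ, ∀ᵐ y, A (fun j => y j + 2 * π * p j) = A y
  symmetric : ∀ᵐ y, (A y).IsSymm

/-- The sesquilinear form
`a^ρ[η](u,v) = ∫_Y A(∇+iη)u · conj((∇+iη)v) dy + ρ² ∫_Y (∇+iη)²u conj((∇+iη)²v) dy`
on `H²_♯(Y)`, which is associated with the shifted operator
`A^ρ(η) = ρ²(∇+iη)⁴ - (∇+iη)·A(y)(∇+iη)`. -/
def blochForm {d : ℕ} (A : (Fin d → ℝ) → Matrix (Fin d) (Fin d) ℝ) (ρ : ℝ)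
    (η : EuclideanSpace ℝ (Fin d)) (u v : H2 d) : ℂ :=
  (∫ y, ∑ j, ∑ k, (A y j k : ℂ) * H2.shiftedDeriv η k u y * conj (H2.shiftedDeriv η j v y)
      ∂(cellMeasure d)) +
    (ρ : ℂ) ^ 2 *
      ∫ y, H2.shiftedLaplacian η u y * conj (H2.shiftedLaplacian η v y) ∂(cellMeasure d)

/-- `φ` is an eigenfunction of `A^ρ(η)` for the eigenvalue `l`: it is a nonzero element of
`H²_♯(Y)` and `A^ρ(η)φ = l φ`, that is, `a^ρ[η](φ,v) = l ∫_Y φ conj(v) dy` for all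
`v ∈ H²_♯(Y)`. The operator is self-adjoint, so that its eigenvalues are real. -/
def IsBlochEigenpair {d : ℕ} (A : (Fin d → ℝ) → Matrix (Fin d) (Fin d) ℝ) (ρ : ℝ)
    (η : EuclideanSpace ℝ (Fin d)) (l : ℝ) (φ : H2 d) : Prop :=
  φ ≠ 0 ∧ ∀ v : H2 d, blochForm A ρ η φ v =
    (l : ℂ) * ∫ y, H2.toL2 φ y * conj (H2.toL2 v y) ∂(cellMeasure d)

/-- The set of eigenvalues of `A^ρ(η)`, the Bloch eigenvalues at the dual parameter `η`. -/
def blochEigenvalues {d : ℕ} (A : (Fin d → ℝ) → Matrix (Fin d) (Fin d) ℝ) (ρ : ℝ)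
    (η : EuclideanSpace ℝ (Fin d)) : Set ℝ :=
  {l | ∃ φ : H2 d, IsBlochEigenpair A ρ η l φ}

/-- The first Bloch eigenvalue `λ_1^ρ(η)`, the smallest eigenvalue of `A^ρ(η)`. -/
def firstBlochEigenvalue {d : ℕ} (A : (Fin d → ℝ) → Matrix (Fin d) (Fin d) ℝ) (ρ : ℝ)
    (η : EuclideanSpace ℝ (Fin d)) : ℝ :=
  sInf (blochEigenvalues A ρ η)

end BlochWave

end

/-! At η = 0 the form vanishes against constants, so the normalized constant e is an eigenfunction
for the eigenvalue 0. The theorem continues this eigenpair analytically and shows that it stays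
lowest; neither compactness of resolvents nor general perturbation theory is used.

The Bloch form and the L² product are represented on H² by bounded operators T(η) and J, so the
problem reads T(η)u = l J u. Here (η, u) ↦ T(η)u is jointly analytic, being polynomial in η and
linear in u (`contDiff_polynomial_operator`). Replacing l by ⟨e, T(η)u⟩ and adding a penalty for ⟨e,
Ju⟩ = 1 gives one equation. Its linearization in u at (0, e) is T(0) plus a rank-one term, coercive
because the Laplacian controls every nonzero Fourier mode (`H2.norm_sq_le_laplacian`). The implicit
function theorem then produces the branch (`exists_analytic_eigenvector`).

Minimality comes from a spectral gap. Eigenfunctions for different eigenvalues are L²-orthogonal,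
and one orthogonal to a nearly constant function has most of its mass in nonzero modes, which forces
its eigenvalue to be at least 3ρ²/64 (`IsBlochEigenpair.le_of_inner_eq_zero`). The branch starts at
0 and lies below this bound near η = 0, so no eigenvalue is smaller. -/

noncomputable section

namespace BlochWave

open scoped ContDiff Topology InnerProductSpace

/-! ### Continuation of a simple eigenvector by the implicit function theorem -/

section ImplicitEigenvector

variable {H : Type*} [NormedAddCommGroup H] [InnerProductSpace ℂ H]

/-- A bounded coercive operator on a complex Hilbert space is invertible. -/
theorem isInvertible_of_coercive [CompleteSpace H] (L : H →L[ℂ] H) {c : ℝ} (hc : 0 < c)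
    (h : ∀ x, c * ‖x‖ ^ 2 ≤ (⟪x, L x⟫_ℂ).re) : (L.restrictScalars ℝ).IsInvertible := by
  have hbound : ∀ x, c * ‖x‖ ≤ ‖L x‖ := by
    intro x
    rcases eq_or_ne x 0 with rfl | hx
    · simp
    · have h0 : 0 < ‖x‖ := norm_pos_iff.mpr hx
      refine le_of_mul_le_mul_left ?_ h0
      calc ‖x‖ * (c * ‖x‖) = c * ‖x‖ ^ 2 := by ring
        _ ≤ (⟪x, L x⟫_ℂ).re := h x
        _ ≤ ‖⟪x, L x⟫_ℂ‖ := Complex.re_le_norm _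
        _ ≤ ‖x‖ * ‖L x‖ := norm_inner_le_norm _ _
  have hanti : AntilipschitzWith (c⁻¹).toNNReal L := by
    refine ContinuousLinearMap.antilipschitz_of_bound L fun x => ?_
    rw [Real.coe_toNNReal _ (inv_pos.mpr hc).le, le_inv_mul_iff₀ hc]
    exact hbound x
  have hker : L.ker = ⊥ := LinearMap.ker_eq_bot.mpr hanti.injective
  have hclosed : IsClosed (L.range : Set H) := hanti.isClosed_range L.uniformContinuous
  -- The range is closed, so it is enough that its orthogonal complement vanishes. A vector x in
  -- that complement is orthogonal to L x, and coercivity gives x = 0.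
  have hrange : L.range = ⊤ := by
    have := hclosed.completeSpace_coe
    rw [← Submodule.orthogonal_eq_bot_iff, Submodule.eq_bot_iff]
    intro x hx
    have h0 : ⟪x, L x⟫_ℂ = 0 := Submodule.inner_left_of_mem_orthogonal
      (LinearMap.mem_range_self _ x) hx
    have h1 := h x
    rw [h0, Complex.zero_re] at h1
    have h2 : ‖x‖ ^ 2 ≤ 0 := by nlinarith [sq_nonneg ‖x‖]
    simpa using h2
  exact ⟨(ContinuousLinearEquiv.ofBijective L hker hrange).restrictScalars ℝ, by ext x; rfl⟩

theorem contDiff_clm_apply_complex {E G : Type*} [NormedAddCommGroup E] [NormedSpace ℝ E]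
    [NormedAddCommGroup G] [NormedSpace ℂ G] (L : H →L[ℂ] G) {g : E → H} (hg : ContDiff ℝ ω g) :
    ContDiff ℝ ω fun x => L (g x) :=
  (L.restrictScalars ℝ).contDiff.comp hg

/-- Analytic continuation of a simple eigenvector of the generalized eigenvalue problem
`T η u = l J u`, normalized by `⟪J e, u⟫ = 1`. -/
theorem exists_analytic_eigenvector [CompleteSpace H] {E : Type*} [NormedAddCommGroup E]
    [NormedSpace ℝ E] [CompleteSpace E] (T : E → H →L[ℂ] H)
    (hT : ContDiff ℝ ω fun p : E × H => T p.1 p.2) (J : H →L[ℂ] H) (e : H)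
    (hTe : T 0 e = 0) (heT : ∀ u, ⟪e, T 0 u⟫_ℂ = 0) (hJ : ∀ u, ⟪J e, u⟫_ℂ = ⟪e, J u⟫_ℂ)
    (hJe : ⟪e, J e⟫_ℂ = 1) {c : ℝ} (hc : 0 < c)
    (hcoer : ∀ u, c * ‖u‖ ^ 2 ≤ (⟪u, T 0 u⟫_ℂ).re + ‖⟪e, J u⟫_ℂ‖ ^ 2) :
    ∃ φ : E → H, AnalyticAt ℝ φ 0 ∧ φ 0 = e ∧
      ∀ᶠ η in 𝓝 0, T η (φ η) = ⟪e, T η (φ η)⟫_ℂ • J (φ η) ∧ ⟪e, J (φ η)⟫_ℂ = 1 := by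
  -- The eigenvalue is eliminated as ⟨e, T u⟩, the value forced by pairing T u = l J u with e when
  -- ⟨e, J u⟩ = 1. The last term enforces this normalization and makes the linearization invertible
  -- in the direction e.
  set F : E × H → H := fun p =>
    T p.1 p.2 - ⟪e, T p.1 p.2⟫_ℂ • J p.2 + (⟪J e, p.2⟫_ℂ - 1) • J e with hF
  have hFs : ContDiff ℝ ω F := by
    have h1 : ContDiff ℝ ω fun p : E × H => ⟪e, T p.1 p.2⟫_ℂ :=
      contDiff_clm_apply_complex (innerSL ℂ e) hT
    have h2 : ContDiff ℝ ω fun p : E × H => ⟪J e, p.2⟫_ℂ :=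
      contDiff_clm_apply_complex (innerSL ℂ (J e)) contDiff_snd
    have h3 : ContDiff ℝ ω fun p : E × H => J p.2 := contDiff_clm_apply_complex J contDiff_snd
    exact (hT.sub (h1.smul h3)).add ((h2.sub contDiff_const).smul contDiff_const)
  have hF0 : F (0, e) = 0 := by simp [hF, hTe, hJ, hJe]
  set L : H →L[ℂ] H := T 0 + (innerSL ℂ (J e)).smulRight (J e) with hL
  have hLinv : (L.restrictScalars ℝ).IsInvertible := by
    refine isInvertible_of_coercive L hc fun u => (hcoer u).trans_eq ?_
    have h1 : ⟪u, J e⟫_ℂ = conj ⟪e, J u⟫_ℂ := by rw [← hJ, inner_conj_symm]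
    have h2 : L u = T 0 u + ⟪e, J u⟫_ℂ • J e := by
      simp [hL, hJ]
    rw [h2, inner_add_right, inner_smul_right, h1, Complex.mul_conj, Complex.add_re,
      Complex.ofReal_re, Complex.normSq_eq_norm_sq]
  have hcd : ContDiffAt ℝ ω F (0, e) := hFs.contDiffAt
  have hderiv : fderiv ℝ F (0, e) ∘L .inr ℝ E H = L.restrictScalars ℝ := by
    have h1 : HasFDerivAt F (fderiv ℝ F (0, e)) (0, e) :=
      (hcd.differentiableAt (by simp)).hasFDerivAt
    have h2 : HasFDerivAt (fun u : H => ((0 : E), u)) (ContinuousLinearMap.inr ℝ E H) e :=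
      hasFDerivAt_prodMk_right 0 e
    have h3 := HasFDerivAt.comp e h1 h2
    -- By `heT` the quadratic term vanishes identically at η = 0, so F(0, ·) is affine with linear
    -- part L and the partial derivative can be read off.
    have h4 : (F ∘ fun u : H => ((0 : E), u)) = fun u => L.restrictScalars ℝ u - J e := by
      funext u
      simp [hF, hL, heT, hJ, sub_smul, add_sub_assoc]
    rw [h4] at h3
    exact h3.unique ((L.restrictScalars ℝ).hasFDerivAt.sub_const (J e))
  have hinv : (fderiv ℝ F (0, e) ∘L .inr ℝ E H).IsInvertible := by rw [hderiv]; exact hLinv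
  have hω : (ω : ℕ∞ω) ≠ 0 := by simp
  set φ := hcd.implicitFunction hω hinv with hφ
  have hφ0 : φ 0 = e := hcd.implicitFunction_apply_self hω hinv
  have hφa : AnalyticAt ℝ φ 0 := (hcd.contDiffAt_implicitFunction hω hinv).analyticAt
  refine ⟨φ, hφa, hφ0, ?_⟩
  have hev := hcd.eventually_apply_implicitFunction hω hinv
  have hcont : ContinuousAt (fun η => ⟪e, T η (φ η)⟫_ℂ) 0 := by
    have h1 : ContinuousAt (fun η => (η, φ η)) 0 := continuousAt_id.prodMk hφa.continuousAt
    have h2 : ContinuousAt (fun η => T η (φ η)) 0 :=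
      ContinuousAt.comp (f := fun η => (η, φ η)) (g := fun p : E × H => T p.1 p.2)
        hT.continuous.continuousAt h1
    exact (innerSL ℂ e).continuous.continuousAt.comp h2
  -- Pairing F = 0 with e gives (⟨e, Tφ⟩ - 1)(1 - ⟨e, Jφ⟩) = 0. Near η = 0 the first factor is close
  -- to -1, so the normalization holds and the penalty term drops out.
  have hne : ∀ᶠ η in 𝓝 (0 : E), ⟪e, T η (φ η)⟫_ℂ ≠ 1 := by
    refine hcont.eventually_ne ?_
    rw [hφ0, hTe, inner_zero_right]
    exact zero_ne_one
  filter_upwards [hev, hne] with η h1 h2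
  change F (η, φ η) = F (0, e) at h1
  rw [hF0] at h1
  simp only [hF] at h1
  have h3 : ⟪e, J (φ η)⟫_ℂ = 1 := by
    have h4 := congrArg (fun x => ⟪e, x⟫_ℂ) h1
    simp only [inner_add_right, inner_sub_right, inner_smul_right, inner_zero_right, hJe, hJ] at h4
    have h5 : (⟪e, T η (φ η)⟫_ℂ - 1) * (1 - ⟪e, J (φ η)⟫_ℂ) = 0 := by linear_combination h4
    rcases mul_eq_zero.mp h5 with h | h
    · exact absurd (sub_eq_zero.mp h) h2
    · exact (sub_eq_zero.mp h).symm
  rw [hJ, h3, sub_self, zero_smul, add_zero] at h1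
  exact ⟨sub_eq_zero.mp h1, h3⟩

end ImplicitEigenvector

/-! ### Fourier coefficients and elementary frequency bounds -/

theorem inner_L2_eq_integral {d : ℕ} (u v : L2 d) :
    ⟪v, u⟫_ℂ = ∫ y, u y * conj (v y) ∂(cellMeasure d) := by
  rw [L2.inner_def]
  simp only [RCLike.inner_apply]

theorem hasSum_norm_sq_repr {d : ℕ} (u : L2 d) :
    HasSum (fun n => ‖(expBasis d).repr u n‖ ^ 2) (‖u‖ ^ 2) := by
  have h := lp.hasSum_norm (p := 2) (by norm_num) ((expBasis d).repr u)
  simpa using h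

theorem expBasis_repr_expL2 {d : ℕ} (m n : Fin d → ℤ) :
    (expBasis d).repr (expL2 m) n = if n = m then 1 else 0 := by
  rw [HilbertBasis.repr_apply_apply, coe_expBasis]
  exact orthonormal_iff_ite.mp (orthonormal_expL2 d) n m

theorem one_le_freqSq {d : ℕ} {n : Fin d → ℤ} (hn : n ≠ 0) : 1 ≤ freqSq n := by
  obtain ⟨j, hj⟩ := Function.ne_iff.mp hn
  have h1 : (n j : ℝ) ^ 2 ≤ freqSq n :=
    Finset.single_le_sum (f := fun j => (n j : ℝ) ^ 2) (fun _ _ => sq_nonneg _) (Finset.mem_univ j)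
  have h2 : (1 : ℤ) ≤ n j ^ 2 := by
    have : n j ≠ 0 := hj
    have := sq_pos_of_ne_zero this
    omega
  have h3 : (1 : ℝ) ≤ (n j : ℝ) ^ 2 := by exact_mod_cast h2
  exact h3.trans h1

theorem norm_coord_le {d : ℕ} (η : EuclideanSpace ℝ (Fin d)) (j : Fin d) : |η j| ≤ ‖η‖ := by
  simpa using PiLp.norm_apply_le η j

/-! ### Completeness of H², bounded differential operators and Fourier-side estimates -/

namespace H2

variable {d : ℕ}

/-- The isometry `u ↦ ((1 + |n|²) û(n))_n` from `H²_♯(Y)` to `ℓ²(ℤ^d)`. -/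
def weightedIsometry : H2 d →ₗᵢ[ℂ] lp (fun _ : Fin d → ℤ => ℂ) 2 where
  toLinearMap := weighted
  norm_map' _ := rfl

/-- Dividing by the weight keeps a sequence in ℓ² because the weight is at least 1. This identifies
H² isometrically with ℓ², whence its completeness, on which adjoints and the implicit function
theorem depend. -/
theorem weighted_surjective : Function.Surjective (weighted (d := d)) := by
  intro f
  have hw : ∀ n : Fin d → ℤ, 1 ≤ weight n := fun n => by
    have := freqSq_nonneg n
    unfold weight; linarith
  have hmem : Memℓp (fun n => (weight n : ℂ)⁻¹ * f n) 2 := by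
    have h2 : 0 < (2 : ℝ≥0∞).toReal := by norm_num
    have h := (memℓp_gen_iff h2).mp (lp.memℓp f)
    refine (memℓp_gen_iff h2).mpr (h.of_nonneg_of_le (fun n => by positivity) fun n => ?_)
    refine Real.rpow_le_rpow (norm_nonneg _) ?_ h2.le
    rw [norm_mul, norm_inv, Complex.norm_real, Real.norm_of_nonneg (weight_pos n).le]
    exact mul_le_of_le_one_left (norm_nonneg _) (inv_le_one_of_one_le₀ (hw n))
  have hcancel : ∀ n, (weight n : ℂ) * ((weight n : ℂ)⁻¹ * f n) = f n := fun n =>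
    mul_inv_cancel_left₀ (by exact_mod_cast (weight_pos n).ne') _
  set u : L2 d := (expBasis d).repr.symm ⟨_, hmem⟩ with hu
  have hrepr : ∀ n, (expBasis d).repr u n = (weight n : ℂ)⁻¹ * f n := fun n => by simp [hu]
  have hmem2 : u ∈ H2Submodule d := by
    change Memℓp (fun n => (weight n : ℂ) * (expBasis d).repr u n) 2
    simp only [hrepr, hcancel]
    exact lp.memℓp f
  refine ⟨(⟨u, hmem2⟩ : H2Submodule d), ?_⟩
  ext n
  change (weight n : ℂ) * (expBasis d).repr u n = f n
  rw [hrepr, hcancel]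

instance : CompleteSpace (H2 d) := by
  have hiso : Isometry (weighted (d := d)) := (weightedIsometry (d := d)).isometry
  refine (completeSpace_iff_isComplete_range hiso.isUniformInducing).mpr ?_
  rw [weighted_surjective.range_eq]
  exact isComplete_univ

theorem norm_multiplier_le (m : (Fin d → ℤ) → ℂ) (hm : ∀ n, ‖m n‖ ≤ weight n) (u : H2 d) :
    ‖multiplier m hm u‖ ≤ ‖u‖ := by
  refine le_of_sq_le_sq ?_ (norm_nonneg _)
  refine hasSum_le (fun n => ?_) (hasSum_norm_sq_repr (multiplier m hm u)) (hasSum_norm_sq u)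
  rw [repr_multiplier, norm_mul, mul_pow]
  gcongr
  exact hm n

theorem norm_toL2_le (u : H2 d) : ‖toL2 u‖ ≤ ‖u‖ := by
  refine le_of_sq_le_sq ?_ (norm_nonneg _)
  refine hasSum_le (fun n => ?_) (hasSum_norm_sq_repr (toL2 u)) (hasSum_norm_sq u)
  refine le_mul_of_one_le_left (sq_nonneg _) (one_le_pow₀ ?_)
  have := freqSq_nonneg n
  unfold weight; linarith

/-- The inclusion of `H²_♯(Y)` in `L²_♯(Y)` as a bounded operator. -/
def toL2CLM : H2 d →L[ℂ] L2 d := toL2.mkContinuous 1 fun u => by rw [one_mul]; exact norm_toL2_le u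

/-- The partial derivative as a bounded operator. -/
def derivCLM (j : Fin d) : H2 d →L[ℂ] L2 d :=
  (deriv j).mkContinuous 1 fun u => by rw [one_mul]; exact norm_multiplier_le _ _ u

/-- The Laplacian as a bounded operator. -/
def laplacianCLM : H2 d →L[ℂ] L2 d :=
  laplacian.mkContinuous 1 fun u => by rw [one_mul]; exact norm_multiplier_le _ _ u

@[simp] theorem toL2CLM_apply (u : H2 d) : toL2CLM u = toL2 u := rfl
@[simp] theorem derivCLM_apply (j : Fin d) (u : H2 d) : derivCLM j u = deriv j u := rfl
@[simp] theorem laplacianCLM_apply (u : H2 d) : laplacianCLM u = laplacian u := rfl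

/-- The operator `∂_j + iη_j` from `H²_♯(Y)` to `L²_♯(Y)`. -/
def shiftedDerivCLM (η : EuclideanSpace ℝ (Fin d)) (j : Fin d) : H2 d →L[ℂ] L2 d :=
  derivCLM j + (Complex.I * (η j : ℂ)) • toL2CLM

/-- The operator `(∇ + iη)²` from `H²_♯(Y)` to `L²_♯(Y)`. -/
def shiftedLaplacianCLM (η : EuclideanSpace ℝ (Fin d)) : H2 d →L[ℂ] L2 d :=
  laplacianCLM + (2 * Complex.I) • (∑ j, (η j : ℂ) • derivCLM j)
    - ((‖η‖ ^ 2 : ℝ) : ℂ) • toL2CLM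

@[simp] theorem shiftedDerivCLM_apply (η : EuclideanSpace ℝ (Fin d)) (j : Fin d) (u : H2 d) :
    shiftedDerivCLM η j u = shiftedDeriv η j u := rfl

@[simp] theorem shiftedLaplacianCLM_apply (η : EuclideanSpace ℝ (Fin d)) (u : H2 d) :
    shiftedLaplacianCLM η u = shiftedLaplacian η u := by
  simp only [shiftedLaplacianCLM, shiftedLaplacian, sub_apply,
    add_apply, smul_apply, sum_apply, toL2CLM_apply,
    derivCLM_apply, laplacianCLM_apply]

/-- Completing the square: -|n|² - 2η·n - |η|² = -|n + η|². -/
theorem repr_shiftedLaplacian (η : EuclideanSpace ℝ (Fin d)) (u : H2 d) (n : Fin d → ℤ) :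
    (expBasis d).repr (shiftedLaplacian η u) n
      = -((∑ j, ((n j : ℝ) + η j) ^ 2 : ℝ) : ℂ) * (expBasis d).repr (toL2 u) n := by
  have hsum : (expBasis d).repr (∑ j, (η j : ℂ) • deriv j u) n
      = (∑ j, (η j : ℂ) * (Complex.I * (n j : ℂ))) * (expBasis d).repr (toL2 u) n := by
    rw [HilbertBasis.repr_apply_apply, inner_sum, Finset.sum_mul]
    refine Finset.sum_congr rfl fun j _ => ?_
    rw [inner_smul_right, ← HilbertBasis.repr_apply_apply, deriv, repr_multiplier]
    ring
  have hsq : (∑ j, ((n j : ℝ) + η j) ^ 2 : ℝ) = freqSq n + 2 * ∑ j, η j * n j + ‖η‖ ^ 2 := by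
    rw [EuclideanSpace.real_norm_sq_eq, freqSq, Finset.mul_sum, ← Finset.sum_add_distrib,
      ← Finset.sum_add_distrib]
    exact Finset.sum_congr rfl fun j _ => by ring
  have hI : (∑ j, (η j : ℂ) * (Complex.I * (n j : ℂ))) = Complex.I * ∑ j, (η j : ℂ) * (n j : ℂ) := by
    rw [Finset.mul_sum]
    exact Finset.sum_congr rfl fun j _ => by ring
  rw [shiftedLaplacian, map_sub, map_add, map_smul, map_smul, lp.coeFn_sub, Pi.sub_apply,
    lp.coeFn_add, Pi.add_apply, lp.coeFn_smul, lp.coeFn_smul, Pi.smul_apply, Pi.smul_apply, hsum,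
    laplacian, repr_multiplier, hsq, hI]
  push_cast
  simp only [smul_eq_mul]
  linear_combination (2 * (∑ j, (η j : ℂ) * (n j : ℂ)) * (expBasis d).repr (toL2 u) n)
    * Complex.I_mul_I

theorem hasSum_norm_sq_shiftedLaplacian (η : EuclideanSpace ℝ (Fin d)) (u : H2 d) :
    HasSum (fun n : Fin d → ℤ =>
      (∑ j, ((n j : ℝ) + η j) ^ 2) ^ 2 * ‖(expBasis d).repr (toL2 u) n‖ ^ 2)
      (‖shiftedLaplacian η u‖ ^ 2) := by
  have h := hasSum_norm_sq_repr (shiftedLaplacian η u)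
  simp only [repr_shiftedLaplacian, norm_mul, norm_neg, Complex.norm_real, mul_pow,
    Real.norm_eq_abs, sq_abs] at h
  exact h

/-- For n ≠ 0 one has |n|² ≥ 1, hence 1 + |n|² ≤ 2|n|², whose square gives the factor 4. The zero
mode has weight 1 and is invisible to the Laplacian, so it is added separately. -/
theorem norm_sq_le_laplacian (u : H2 d) :
    ‖u‖ ^ 2 ≤ 4 * ‖shiftedLaplacian 0 u‖ ^ 2 + ‖(expBasis d).repr (toL2 u) 0‖ ^ 2 := by
  have h0 := hasSum_ite_eq (0 : Fin d → ℤ) (‖(expBasis d).repr (toL2 u) 0‖ ^ 2)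
  refine hasSum_le (fun n => ?_) (hasSum_norm_sq u)
    (((hasSum_norm_sq_shiftedLaplacian 0 u).mul_left 4).add h0)
  have hs : (∑ j, ((n j : ℝ) + (0 : EuclideanSpace ℝ (Fin d)) j) ^ 2) = freqSq n := by
    simp [freqSq]
  rw [hs]
  split_ifs with hn
  · subst hn
    simp [weight, freqSq]
  · have h1 := one_le_freqSq hn
    have h2 : weight n ^ 2 ≤ 4 * freqSq n ^ 2 := by unfold weight; nlinarith
    rw [add_zero, ← mul_assoc]
    gcongr

/-- If n_j ≠ 0 then |n_j + η_j| ≥ 1 - 1/2, so the symbol |n + η|² is at least 1/4 and its square at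
least 1/16. This is uniform in η, as the spectral gap requires. -/
theorem norm_sq_toL2_le_shiftedLaplacian {η : EuclideanSpace ℝ (Fin d)} (hη : ‖η‖ ≤ 1 / 2)
    (u : H2 d) :
    ‖toL2 u‖ ^ 2 ≤ 16 * ‖shiftedLaplacian η u‖ ^ 2 + ‖(expBasis d).repr (toL2 u) 0‖ ^ 2 := by
  have h0 := hasSum_ite_eq (0 : Fin d → ℤ) (‖(expBasis d).repr (toL2 u) 0‖ ^ 2)
  refine hasSum_le (fun n => ?_) (hasSum_norm_sq_repr (toL2 u))
    (((hasSum_norm_sq_shiftedLaplacian η u).mul_left 16).add h0)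
  split_ifs with hn
  · subst hn
    have : 0 ≤ 16 * ((∑ j, ((((0 : Fin d → ℤ) j : ℤ) : ℝ) + η j) ^ 2) ^ 2 *
      ‖(expBasis d).repr (toL2 u) 0‖ ^ 2) := by positivity
    linarith
  · obtain ⟨j, hj⟩ := Function.ne_iff.mp hn
    have h1 : ((n j : ℝ) + η j) ^ 2 ≤ ∑ j, ((n j : ℝ) + η j) ^ 2 :=
      Finset.single_le_sum (f := fun j => ((n j : ℝ) + η j) ^ 2) (fun _ _ => sq_nonneg _)
        (Finset.mem_univ j)
    have h2 : (1 : ℝ) ≤ |(n j : ℝ)| := by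
      have : (1 : ℤ) ≤ |n j| := Int.one_le_abs hj
      exact_mod_cast this
    have h3 : (1 / 2 : ℝ) ≤ |(n j : ℝ) + η j| := by
      have h4 := abs_sub_abs_le_abs_sub (n j : ℝ) (-η j)
      rw [abs_neg, sub_neg_eq_add] at h4
      have h5 := (norm_coord_le η j).trans hη
      linarith
    have h4 : (1 / 4 : ℝ) ≤ ∑ j, ((n j : ℝ) + η j) ^ 2 := by
      refine le_trans ?_ h1
      rw [← sq_abs]
      nlinarith
    have h5 : (1 : ℝ) ≤ 16 * (∑ j, ((n j : ℝ) + η j) ^ 2) ^ 2 := by nlinarith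
    rw [add_zero, ← mul_assoc]
    exact le_mul_of_one_le_left (sq_nonneg _) h5

/-- The normalized constant function as an element of `H²_♯(Y)`. -/
def const (d : ℕ) : H2 d :=
  (⟨expL2 0, by
    change Memℓp (fun n => (weight n : ℂ) * (expBasis d).repr (expL2 0) n) 2
    refine (congrArg (fun f => Memℓp f 2) ?_).mp (lp.memℓp ((expBasis d).repr (expL2 0)))
    funext n
    rw [expBasis_repr_expL2]
    split_ifs with h
    · subst h; simp [weight, freqSq]
    · simp⟩ : H2Submodule d)

theorem toL2_const : toL2 (const d) = expL2 0 := rfl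

theorem repr_eq_zero_imp {u : L2 d} (h : ∀ n, (expBasis d).repr u n = 0) : u = 0 := by
  have : (expBasis d).repr u = 0 := by
    ext n; simpa using h n
  simpa using this

theorem shiftedDeriv_zero_const (j : Fin d) : shiftedDeriv 0 j (const d) = 0 := by
  refine repr_eq_zero_imp fun n => ?_
  have h : shiftedDeriv 0 j (const d) = deriv j (const d) := by simp [shiftedDeriv]
  rw [h, deriv, repr_multiplier, toL2_const, expBasis_repr_expL2]
  split_ifs with hn
  · subst hn; simp
  · simp

theorem shiftedLaplacian_zero_const : shiftedLaplacian 0 (const d) = 0 := by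
  refine repr_eq_zero_imp fun n => ?_
  rw [repr_shiftedLaplacian, toL2_const, expBasis_repr_expL2]
  split_ifs with hn
  · subst hn; simp
  · simp

theorem inner_const_left (u : L2 d) : ⟪toL2 (const d), u⟫_ℂ = (expBasis d).repr u 0 := by
  rw [HilbertBasis.repr_apply_apply, coe_expBasis, toL2_const]

end H2
open ContinuousLinearMap (adjoint)

variable {d : ℕ}

/-! ### Joint analyticity of operators polynomial in the parameter -/

section PolynomialOperator

variable {H K : Type*} [NormedAddCommGroup H] [InnerProductSpace ℂ H]
  [NormedAddCommGroup K] [InnerProductSpace ℂ K]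

/-- The argument is an arbitrary analytic function g of η and a further variable, so that the
shifted operators and their adjoints can be composed; the constant c is i for the former and -i for
the latter. -/
theorem contDiff_first_order (D ι : H →L[ℂ] K) (c : ℂ) (j : Fin d)
    {X : Type*} [NormedAddCommGroup X] [NormedSpace ℝ X]
    {g : EuclideanSpace ℝ (Fin d) × X → H} (hg : ContDiff ℝ ω g) :
    ContDiff ℝ ω fun p : EuclideanSpace ℝ (Fin d) × X =>
      (D + (c * ((p.1 j : ℝ) : ℂ)) • ι) (g p) := by
  have hc : ContDiff ℝ ω fun p : EuclideanSpace ℝ (Fin d) × X => ((p.1 j : ℝ) : ℂ) :=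
    (Complex.ofRealCLM.comp (EuclideanSpace.proj j)).contDiff.comp contDiff_fst
  simp only [add_apply, smul_apply]
  exact (contDiff_clm_apply_complex D hg).add
    ((contDiff_const.mul hc).smul (contDiff_clm_apply_complex ι hg))

theorem contDiff_second_order (D : Fin d → H →L[ℂ] K) (Δ ι : H →L[ℂ] K) (c : ℂ)
    {X : Type*} [NormedAddCommGroup X] [NormedSpace ℝ X]
    {g : EuclideanSpace ℝ (Fin d) × X → H} (hg : ContDiff ℝ ω g) :
    ContDiff ℝ ω fun p : EuclideanSpace ℝ (Fin d) × X =>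
      (Δ + c • (∑ j, ((p.1 j : ℝ) : ℂ) • D j) - ((‖p.1‖ ^ 2 : ℝ) : ℂ) • ι) (g p) := by
  have hc : ∀ j, ContDiff ℝ ω fun p : EuclideanSpace ℝ (Fin d) × X => ((p.1 j : ℝ) : ℂ) :=
    fun j => (Complex.ofRealCLM.comp (EuclideanSpace.proj j)).contDiff.comp contDiff_fst
  have hn : ContDiff ℝ ω fun p : EuclideanSpace ℝ (Fin d) × X => ((‖p.1‖ ^ 2 : ℝ) : ℂ) :=
    Complex.ofRealCLM.contDiff.comp ((contDiff_norm_sq ℝ).comp contDiff_fst)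
  simp only [sub_apply, add_apply, smul_apply, sum_apply]
  exact ((contDiff_clm_apply_complex Δ hg).add (contDiff_const.smul (ContDiff.sum fun j _ =>
    (hc j).smul (contDiff_clm_apply_complex (D j) hg)))).sub
    (hn.smul (contDiff_clm_apply_complex ι hg))

/-- The operators in divergence form that depend polynomially on the parameter `η` in the manner of
the shifted operators are jointly analytic. -/
theorem contDiff_polynomial_operator [CompleteSpace H] [CompleteSpace K]
    (D : Fin d → H →L[ℂ] K) (Δ ι : H →L[ℂ] K) (M : Fin d → Fin d → K →L[ℂ] K) (r : ℂ) :
    ContDiff ℝ ω fun p : EuclideanSpace ℝ (Fin d) × H =>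
      (∑ j, ∑ k, adjoint (D j + (Complex.I * ((p.1 j : ℝ) : ℂ)) • ι)
        (M j k ((D k + (Complex.I * ((p.1 k : ℝ) : ℂ)) • ι) p.2))) +
      r • adjoint (Δ + (2 * Complex.I) • (∑ j, ((p.1 j : ℝ) : ℂ) • D j)
          - ((‖p.1‖ ^ 2 : ℝ) : ℂ) • ι)
        ((Δ + (2 * Complex.I) • (∑ j, ((p.1 j : ℝ) : ℂ) • D j)
          - ((‖p.1‖ ^ 2 : ℝ) : ℂ) • ι) p.2) := by
  -- Taking adjoints is conjugate-linear, but η is real: only i changes sign, and the adjoint is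
  -- again polynomial in η.
  have h1 : ∀ (t : ℝ) (j : Fin d), adjoint (D j + (Complex.I * (t : ℂ)) • ι) =
      adjoint (D j) + (-Complex.I * (t : ℂ)) • adjoint ι := by
    intro t j
    rw [map_add, map_smulₛₗ, map_mul, Complex.conj_I, Complex.conj_ofReal]
  have h2 : ∀ η : EuclideanSpace ℝ (Fin d),
      adjoint (Δ + (2 * Complex.I) • (∑ j, ((η j : ℝ) : ℂ) • D j)
        - ((‖η‖ ^ 2 : ℝ) : ℂ) • ι) =
      adjoint Δ + (2 * -Complex.I) • (∑ j, ((η j : ℝ) : ℂ) • adjoint (D j))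
        - ((‖η‖ ^ 2 : ℝ) : ℂ) • adjoint ι := by
    intro η
    rw [map_sub, map_add, map_smulₛₗ, map_smulₛₗ, map_sum]
    simp only [map_smulₛₗ, Complex.conj_ofReal, map_mul, Complex.conj_I, map_ofNat]
  simp only [h1, h2]
  exact (ContDiff.sum fun j _ => ContDiff.sum fun k _ => contDiff_first_order _ _ _ j
    (contDiff_clm_apply_complex _ (contDiff_first_order _ _ _ k contDiff_snd))).add
    (contDiff_const.smul (contDiff_second_order _ _ _ _
      (contDiff_second_order _ _ _ _ contDiff_snd)))

end PolynomialOperator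

/-! ### Operator representation of the Bloch form, its symmetry and lower bound -/

/-- Multiplication by an essentially bounded function as a bounded operator on `L²_♯(Y)`. -/
def mulCLM (a : Lp ℂ ∞ (cellMeasure d)) : L2 d →L[ℂ] L2 d :=
  (ContinuousLinearMap.mul ℂ ℂ).holderL (cellMeasure d) ∞ 2 2 a

theorem coeFn_mulCLM (a : Lp ℂ ∞ (cellMeasure d)) (u : L2 d) :
    mulCLM a u =ᵐ[cellMeasure d] fun y => a y * u y :=
  (ContinuousLinearMap.mul ℂ ℂ).coeFn_holder a u

namespace IsCoefficientMatrix

variable {A : (Fin d → ℝ) → Matrix (Fin d) (Fin d) ℝ}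

theorem memLp_entry (hA : IsCoefficientMatrix A) (j k : Fin d) :
    MemLp (fun y => (A y j k : ℂ)) ∞ (cellMeasure d) := by
  obtain ⟨M, hM⟩ := hA.bounded
  refine memLp_top_of_bound
    (Complex.measurable_ofReal.comp_aemeasurable
      (hA.measurable j k).restrict).aestronglyMeasurable M ?_
  filter_upwards [ae_restrict_of_ae hM] with y hy
  rw [Complex.norm_real, Real.norm_eq_abs]
  exact hy j k

/-- The operator on `H²_♯(Y)` that represents the Bloch form through the inner product of
`H²_♯(Y)`. -/
def blochOp (hA : IsCoefficientMatrix A) (ρ : ℝ) (η : EuclideanSpace ℝ (Fin d)) :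
    H2 d →L[ℂ] H2 d :=
  (∑ j, ∑ k, adjoint (H2.shiftedDerivCLM η j) ∘L mulCLM (hA.memLp_entry j k).toLp ∘L
      H2.shiftedDerivCLM η k) +
    ((ρ : ℂ) ^ 2) • (adjoint (H2.shiftedLaplacianCLM η) ∘L H2.shiftedLaplacianCLM η)

theorem blochOp_apply (hA : IsCoefficientMatrix A) (ρ : ℝ) (η : EuclideanSpace ℝ (Fin d))
    (u : H2 d) : hA.blochOp ρ η u =
      (∑ j, ∑ k, adjoint (H2.shiftedDerivCLM η j)
        (mulCLM (hA.memLp_entry j k).toLp (H2.shiftedDerivCLM η k u))) +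
      ((ρ : ℂ) ^ 2) • adjoint (H2.shiftedLaplacianCLM η) (H2.shiftedLaplacianCLM η u) := by
  simp only [blochOp, add_apply, sum_apply, smul_apply, ContinuousLinearMap.comp_apply]

theorem entry_mul_ae (hA : IsCoefficientMatrix A) (j k : Fin d) (f g : L2 d) :
    (fun y => ⟪g y, mulCLM (hA.memLp_entry j k).toLp f y⟫_ℂ) =ᵐ[cellMeasure d]
      fun y => (A y j k : ℂ) * f y * conj (g y) := by
  filter_upwards [coeFn_mulCLM (hA.memLp_entry j k).toLp f, (hA.memLp_entry j k).coeFn_toLp]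
    with y h1 h2
  rw [h1, h2, RCLike.inner_apply]

theorem integrable_entry_mul (hA : IsCoefficientMatrix A) (j k : Fin d) (f g : L2 d) :
    Integrable (fun y => (A y j k : ℂ) * f y * conj (g y)) (cellMeasure d) :=
  (L2.integrable_inner g (mulCLM (hA.memLp_entry j k).toLp f)).congr (hA.entry_mul_ae j k f g)

theorem inner_mulCLM_entry (hA : IsCoefficientMatrix A) (j k : Fin d) (f g : L2 d) :
    ⟪g, mulCLM (hA.memLp_entry j k).toLp f⟫_ℂ
      = ∫ y, (A y j k : ℂ) * f y * conj (g y) ∂(cellMeasure d) := by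
  rw [L2.inner_def]
  exact integral_congr_ae (hA.entry_mul_ae j k f g)

theorem inner_blochOp (hA : IsCoefficientMatrix A) (ρ : ℝ) (η : EuclideanSpace ℝ (Fin d))
    (u v : H2 d) : ⟪v, hA.blochOp ρ η u⟫_ℂ = blochForm A ρ η u v := by
  rw [blochOp_apply, inner_add_right, inner_sum, inner_smul_right,
    ContinuousLinearMap.adjoint_inner_right, inner_L2_eq_integral, blochForm,
    integral_finsetSum _ fun j _ => integrable_finsetSum _ fun k _ =>
      hA.integrable_entry_mul j k _ _]
  refine congrArg₂ _ (Finset.sum_congr rfl fun j _ => ?_) (by rw [H2.shiftedLaplacianCLM_apply,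
    H2.shiftedLaplacianCLM_apply])
  rw [inner_sum, integral_finsetSum _ fun k _ => hA.integrable_entry_mul j k _ _]
  refine Finset.sum_congr rfl fun k _ => ?_
  rw [ContinuousLinearMap.adjoint_inner_right, hA.inner_mulCLM_entry]
  rfl

/-- Conjugation exchanges the roles of the two summation indices, and the real symmetric matrix A
absorbs the exchange. Reality of the branch and orthogonality of eigenfunctions rest on this. -/
theorem conj_blochForm (hA : IsCoefficientMatrix A) (ρ : ℝ) (η : EuclideanSpace ℝ (Fin d))
    (u v : H2 d) : conj (blochForm A ρ η u v) = blochForm A ρ η v u := by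
  rw [blochForm, blochForm, map_add, map_mul, map_pow, Complex.conj_ofReal, ← integral_conj,
    ← integral_conj]
  congr 1
  · refine integral_congr_ae ?_
    filter_upwards [ae_restrict_of_ae hA.symmetric] with y hy
    simp only [map_sum, map_mul, Complex.conj_conj, Complex.conj_ofReal]
    rw [Finset.sum_comm]
    refine Finset.sum_congr rfl fun k _ => Finset.sum_congr rfl fun j _ => ?_
    rw [hy.apply k j]
    ring
  · congr 1
    refine integral_congr_ae (Filter.Eventually.of_forall fun y => ?_)
    simp only [map_mul, Complex.conj_conj]
    ring

/-- Ellipticity, applied to the real and imaginary parts of the shifted gradient separately, makes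
the second-order part nonnegative, and it is discarded. All coercivity comes from the fourth-order
term, so the constants depend on ρ and not on α. -/
theorem le_re_blochForm_self (hA : IsCoefficientMatrix A) (ρ : ℝ) (η : EuclideanSpace ℝ (Fin d))
    (u : H2 d) : ρ ^ 2 * ‖H2.shiftedLaplacian η u‖ ^ 2 ≤ (blochForm A ρ η u u).re := by
  obtain ⟨α, hα, hell⟩ := hA.elliptic
  have hint : Integrable (fun y => ∑ j, ∑ k, (A y j k : ℂ) * H2.shiftedDeriv η k u y *
      conj (H2.shiftedDeriv η j u y)) (cellMeasure d) :=
    integrable_finsetSum _ fun j _ => integrable_finsetSum _ fun k _ =>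
      hA.integrable_entry_mul j k _ _
  have h1 : 0 ≤ (∫ y, ∑ j, ∑ k, (A y j k : ℂ) * H2.shiftedDeriv η k u y *
      conj (H2.shiftedDeriv η j u y) ∂(cellMeasure d)).re := by
    have h2 := integral_re (𝕜 := ℂ) hint
    simp only [RCLike.re_to_complex] at h2
    rw [← h2]
    refine integral_nonneg_of_ae ?_
    filter_upwards [ae_restrict_of_ae hell] with y hy
    have hx := hy fun j => (H2.shiftedDeriv η j u y).re
    have hz := hy fun j => (H2.shiftedDeriv η j u y).im
    have hnn : ∀ ξ : Fin d → ℝ, 0 ≤ α * (ξ ⬝ᵥ ξ) := fun ξ =>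
      mul_nonneg hα.le (Finset.sum_nonneg fun _ _ => mul_self_nonneg _)
    have hsum := add_nonneg ((hnn _).trans hx) ((hnn _).trans hz)
    refine hsum.trans_eq ?_
    simp only [Matrix.mulVec, dotProduct, Complex.re_sum]
    rw [← Finset.sum_add_distrib]
    refine Finset.sum_congr rfl fun j _ => ?_
    rw [Finset.sum_mul, Finset.sum_mul, ← Finset.sum_add_distrib]
    refine Finset.sum_congr rfl fun k _ => ?_
    simp
  have h3 : (∫ y, H2.shiftedLaplacian η u y * conj (H2.shiftedLaplacian η u y)
      ∂(cellMeasure d)) = ((‖H2.shiftedLaplacian η u‖ ^ 2 : ℝ) : ℂ) := by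
    rw [← inner_L2_eq_integral, inner_self_eq_norm_sq_to_K]
    simp
  rw [blochForm, h3, Complex.add_re, ← Complex.ofReal_pow, ← Complex.ofReal_mul, Complex.ofReal_re]
  linarith

theorem contDiff_blochOp (hA : IsCoefficientMatrix A) (ρ : ℝ) :
    ContDiff ℝ ω fun p : EuclideanSpace ℝ (Fin d) × H2 d => hA.blochOp ρ p.1 p.2 := by
  simp only [blochOp_apply]
  exact contDiff_polynomial_operator H2.derivCLM H2.laplacianCLM H2.toL2CLM
    (fun j k => mulCLM (hA.memLp_entry j k).toLp) ((ρ : ℂ) ^ 2)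

theorem blochOp_zero_const (hA : IsCoefficientMatrix A) (ρ : ℝ) :
    hA.blochOp ρ 0 (H2.const d) = 0 := by
  rw [blochOp_apply]
  simp [H2.shiftedDeriv_zero_const, H2.shiftedLaplacian_zero_const]

/-- By symmetry of the form, the operator at η = 0 moves onto the constant, which it annihilates. -/
theorem inner_const_blochOp_zero (hA : IsCoefficientMatrix A) (ρ : ℝ) (u : H2 d) :
    ⟪H2.const d, hA.blochOp ρ 0 u⟫_ℂ = 0 := by
  rw [inner_blochOp, ← hA.conj_blochForm, ← hA.inner_blochOp, blochOp_zero_const,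
    inner_zero_right, map_zero]

end IsCoefficientMatrix

/-- The operator on `H²_♯(Y)` that represents the inner product of `L²_♯(Y)`. -/
def massOp (d : ℕ) : H2 d →L[ℂ] H2 d := adjoint H2.toL2CLM ∘L H2.toL2CLM

theorem inner_massOp (u v : H2 d) : ⟪v, massOp d u⟫_ℂ = ⟪H2.toL2 v, H2.toL2 u⟫_ℂ := by
  rw [massOp, ContinuousLinearMap.comp_apply, ContinuousLinearMap.adjoint_inner_right]
  rfl

theorem inner_const_massOp (u : H2 d) :
    ⟪H2.const d, massOp d u⟫_ℂ = (expBasis d).repr (H2.toL2 u) 0 := by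
  rw [inner_massOp, H2.inner_const_left]

theorem massOp_inner (u v : H2 d) : ⟪massOp d v, u⟫_ℂ = ⟪v, massOp d u⟫_ℂ := by
  rw [← inner_conj_symm, inner_massOp, inner_conj_symm, inner_massOp]

/-! ### Orthogonality of eigenfunctions and the spectral gap -/

section Eigenpairs

variable {A : (Fin d → ℝ) → Matrix (Fin d) (Fin d) ℝ} {ρ : ℝ} {η : EuclideanSpace ℝ (Fin d)}

theorem isBlochEigenpair_iff {l : ℝ} {φ : H2 d} : IsBlochEigenpair A ρ η l φ ↔
    φ ≠ 0 ∧ ∀ v, blochForm A ρ η φ v = (l : ℂ) * ⟪H2.toL2 v, H2.toL2 φ⟫_ℂ := by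
  simp only [IsBlochEigenpair, inner_L2_eq_integral]

/-- Eigenfunctions for different eigenvalues are orthogonal in `L²_♯(Y)`. -/
theorem IsBlochEigenpair.inner_eq_zero (hA : IsCoefficientMatrix A) {l μ : ℝ} {φ ψ : H2 d}
    (hφ : IsBlochEigenpair A ρ η l φ) (hψ : IsBlochEigenpair A ρ η μ ψ) (hne : l ≠ μ) :
    ⟪H2.toL2 φ, H2.toL2 ψ⟫_ℂ = 0 := by
  have h1 := (isBlochEigenpair_iff.mp hφ).2 ψ
  have h2 := (isBlochEigenpair_iff.mp hψ).2 φ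
  rw [← hA.conj_blochForm, h1, map_mul, Complex.conj_ofReal, inner_conj_symm] at h2
  have h3 : ((l : ℂ) - μ) * ⟪H2.toL2 φ, H2.toL2 ψ⟫_ℂ = 0 := by linear_combination h2
  rcases mul_eq_zero.mp h3 with h | h
  · exact absurd (by exact_mod_cast sub_eq_zero.mp h) hne
  · exact h

/-- A spectral gap: an eigenfunction that is orthogonal to an almost constant function has an
eigenvalue that is bounded away from zero. -/
theorem IsBlochEigenpair.le_of_inner_eq_zero (hA : IsCoefficientMatrix A) (hη : ‖η‖ ≤ 1 / 2)
    {μ : ℝ} {φ ψ : H2 d} (hψ : IsBlochEigenpair A ρ η μ ψ)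
    (hφ : ‖H2.toL2 φ - H2.toL2 (H2.const d)‖ ≤ 1 / 2)
    (horth : ⟪H2.toL2 φ, H2.toL2 ψ⟫_ℂ = 0) : 3 * ρ ^ 2 / 64 ≤ μ := by
  have hpos : 0 < ‖H2.toL2 ψ‖ := norm_pos_iff.mpr fun h =>
    hψ.1 (H2.toL2_injective (h.trans (map_zero _).symm))
  -- The zero mode of ψ is its product with the constant. Since ψ is orthogonal to φ, only the
  -- difference of φ and the constant contributes.
  have h1 : ‖(expBasis d).repr (H2.toL2 ψ) 0‖ ≤ 1 / 2 * ‖H2.toL2 ψ‖ := by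
    have h2 : (expBasis d).repr (H2.toL2 ψ) 0
        = -⟪H2.toL2 φ - H2.toL2 (H2.const d), H2.toL2 ψ⟫_ℂ := by
      rw [inner_sub_left, horth, H2.inner_const_left]
      ring
    rw [h2, norm_neg]
    exact (norm_inner_le_norm _ _).trans (by gcongr)
  have h3 := H2.norm_sq_toL2_le_shiftedLaplacian hη ψ
  have h4 := hA.le_re_blochForm_self ρ η ψ
  rw [(isBlochEigenpair_iff.mp hψ).2 ψ, inner_self_eq_norm_sq_to_K] at h4
  have h5 : ((μ : ℂ) * ((‖H2.toL2 ψ‖ : ℝ) : ℂ) ^ 2).re = μ * ‖H2.toL2 ψ‖ ^ 2 := by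
    rw [← Complex.ofReal_pow, ← Complex.ofReal_mul, Complex.ofReal_re]
  change _ ≤ ((μ : ℂ) * ((‖H2.toL2 ψ‖ : ℝ) : ℂ) ^ 2).re at h4
  rw [h5] at h4
  have h6 : ‖(expBasis d).repr (H2.toL2 ψ) 0‖ ^ 2 ≤ 1 / 4 * ‖H2.toL2 ψ‖ ^ 2 := by
    calc _ ≤ (1 / 2 * ‖H2.toL2 ψ‖) ^ 2 := by gcongr
      _ = _ := by ring
  -- The zero mode carries at most 1/4 of ‖ψ‖², and the remaining 3/4 is divided by the factor 16 of
  -- the Fourier estimate.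
  have h7 : 3 / 64 * ‖H2.toL2 ψ‖ ^ 2 ≤ ‖H2.shiftedLaplacian η ψ‖ ^ 2 := by linarith
  have h8 := mul_le_mul_of_nonneg_left h7 (sq_nonneg ρ)
  refine le_of_mul_le_mul_right ?_ (pow_pos hpos 2)
  linarith

end Eigenpairs

theorem ball_subset_dualCell {δ : ℝ} (hδ : δ ≤ 1 / 2) :
    Metric.ball (0 : EuclideanSpace ℝ (Fin d)) δ ⊆ dualCell d := by
  intro η hη j
  rw [mem_ball_zero_iff] at hη
  have h := abs_lt.mp ((norm_coord_le η j).trans_lt (hη.trans_le hδ))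
  exact ⟨h.1.le, h.2⟩

end BlochWave

/-! ### The analytic branch is the first Bloch eigenvalue -/

theorem theorem3p1 (d : ℕ) (A : (Fin d → ℝ) → Matrix (Fin d) (Fin d) ℝ)
    (hA : BlochWave.IsCoefficientMatrix A) (ρ : ℝ) (hρ : 0 < ρ) :
    ∃ δ : ℝ, 0 < δ ∧
      Metric.ball (0 : EuclideanSpace ℝ (Fin d)) δ ⊆ BlochWave.dualCell d ∧
      (∀ η ∈ Metric.ball (0 : EuclideanSpace ℝ (Fin d)) δ,
        IsLeast (BlochWave.blochEigenvalues A ρ η) (BlochWave.firstBlochEigenvalue A ρ η)) ∧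
      AnalyticOnNhd ℝ (BlochWave.firstBlochEigenvalue A ρ)
        (Metric.ball (0 : EuclideanSpace ℝ (Fin d)) δ) ∧
      ∃ φ : EuclideanSpace ℝ (Fin d) → BlochWave.H2 d,
        AnalyticOnNhd ℝ φ (Metric.ball (0 : EuclideanSpace ℝ (Fin d)) δ) ∧
        ∀ η ∈ Metric.ball (0 : EuclideanSpace ℝ (Fin d)) δ,
          BlochWave.IsBlochEigenpair A ρ η (BlochWave.firstBlochEigenvalue A ρ η) (φ η) := by
  open BlochWave in
  open scoped InnerProductSpace Topology ContDiff in
  have hconst : ⟪H2.const d, massOp d (H2.const d)⟫_ℂ = 1 := by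
    rw [inner_const_massOp, H2.toL2_const, expBasis_repr_expL2, if_pos rfl]
  -- In ‖u‖² ≤ 4‖Δu‖² + |û(0)|² the form pays for the first term at the rate ρ²/4 and the rank-one
  -- term pays for the second at the rate 1; the minimum serves both.
  have hcoer : ∀ u, min (ρ ^ 2 / 4) 1 * ‖u‖ ^ 2 ≤
      (⟪u, hA.blochOp ρ 0 u⟫_ℂ).re + ‖⟪H2.const d, massOp d u⟫_ℂ‖ ^ 2 := by
    intro u
    rw [hA.inner_blochOp, inner_const_massOp]
    have h1 := hA.le_re_blochForm_self ρ 0 u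
    have h2 := H2.norm_sq_le_laplacian u
    have h3 : 0 ≤ min (ρ ^ 2 / 4) 1 := by positivity
    calc min (ρ ^ 2 / 4) 1 * ‖u‖ ^ 2
        ≤ min (ρ ^ 2 / 4) 1 * (4 * ‖H2.shiftedLaplacian 0 u‖ ^ 2) +
          min (ρ ^ 2 / 4) 1 * ‖(expBasis d).repr (H2.toL2 u) 0‖ ^ 2 := by
          rw [← mul_add]
          gcongr
      _ ≤ ρ ^ 2 / 4 * (4 * ‖H2.shiftedLaplacian 0 u‖ ^ 2) +
          1 * ‖(expBasis d).repr (H2.toL2 u) 0‖ ^ 2 := by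
          gcongr
          · exact min_le_left _ _
          · exact min_le_right _ _
      _ ≤ _ := by linarith
  obtain ⟨φ, hφa, hφ0, hφ⟩ := exists_analytic_eigenvector (hA.blochOp ρ)
    (hA.contDiff_blochOp ρ) (massOp d) (H2.const d) (hA.blochOp_zero_const ρ)
    (hA.inner_const_blochOp_zero ρ) (fun u => massOp_inner u _) hconst
    (lt_min (by positivity) one_pos) hcoer
  set l : EuclideanSpace ℝ (Fin d) → ℝ := fun η =>
    (⟪H2.const d, hA.blochOp ρ η (φ η)⟫_ℂ).re with hl
  have hlsmooth : ContDiff ℝ ω fun p : EuclideanSpace ℝ (Fin d) × H2 d =>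
      (⟪H2.const d, hA.blochOp ρ p.1 p.2⟫_ℂ).re :=
    Complex.reCLM.contDiff.comp
      (contDiff_clm_apply_complex (innerSL ℂ (H2.const d)) (hA.contDiff_blochOp ρ))
  have hla : ∀ η, AnalyticAt ℝ φ η → AnalyticAt ℝ l η := fun η h =>
    AnalyticAt.comp (g := fun p : EuclideanSpace ℝ (Fin d) × H2 d =>
      (⟪H2.const d, hA.blochOp ρ p.1 p.2⟫_ℂ).re) (f := fun η => (η, φ η))
      hlsmooth.contDiffAt.analyticAt (analyticAt_id.prod h)
  have hlsmall : ∀ᶠ η in 𝓝 0, l η < 3 * ρ ^ 2 / 64 := by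
    refine (hla 0 hφa).continuousAt.eventually_lt_const ?_
    simp only [hl, hφ0, hA.blochOp_zero_const, inner_zero_right, Complex.zero_re]
    positivity
  have hclose : ∀ᶠ η in 𝓝 0, ‖H2.toL2 (φ η) - H2.toL2 (H2.const d)‖ < 1 / 2 := by
    have h1 : ContinuousAt (fun η => ‖H2.toL2CLM (φ η) - H2.toL2CLM (H2.const d)‖) 0 :=
      ((H2.toL2CLM.continuous.continuousAt.comp hφa.continuousAt).sub continuousAt_const).norm
    refine h1.eventually_lt_const ?_
    simp only [hφ0, sub_self, norm_zero]
    positivity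
  obtain ⟨ε, hε, hball⟩ := Metric.eventually_nhds_iff_ball.mp
    (hφ.and (hφa.eventually_analyticAt.and (hlsmall.and hclose)))
  -- The cap 1/2 keeps the ball in the dual cell and also provides the bound on ‖η‖ that the
  -- spectral gap needs.
  refine ⟨min ε (1 / 2), by positivity, ball_subset_dualCell (min_le_right _ _), ?_⟩
  set U := Metric.ball (0 : EuclideanSpace ℝ (Fin d)) (min ε (1 / 2)) with hU
  have hsub : ∀ η ∈ U, η ∈ Metric.ball (0 : EuclideanSpace ℝ (Fin d)) ε := fun η h =>
    Metric.ball_subset_ball (min_le_left _ _) h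
  have hpair : ∀ η ∈ U, IsBlochEigenpair A ρ η (l η) (φ η) := by
    intro η hη
    obtain ⟨⟨h1, h2⟩, -⟩ := hball η (hsub η hη)
    have hne : φ η ≠ 0 := fun h => by simp [h] at h2
    have hform : ∀ v, blochForm A ρ η (φ η) v =
        ⟪H2.const d, hA.blochOp ρ η (φ η)⟫_ℂ * ⟪H2.toL2 v, H2.toL2 (φ η)⟫_ℂ := by
      intro v
      rw [← hA.inner_blochOp, ← inner_massOp, ← inner_smul_right, ← h1]
    -- The implicit function theorem yields an eigenvalue that is a priori complex. The form is real
    -- on the diagonal and φ has nonzero L² norm, so the eigenvalue equals its real part.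
    have hreal : ((l η : ℝ) : ℂ) = ⟪H2.const d, hA.blochOp ρ η (φ η)⟫_ℂ := by
      have h3 := hA.conj_blochForm ρ η (φ η) (φ η)
      rw [hform, map_mul, inner_conj_symm (H2.toL2 (φ η))] at h3
      have h4 : ⟪H2.toL2 (φ η), H2.toL2 (φ η)⟫_ℂ ≠ 0 := inner_self_ne_zero.mpr fun h =>
        hne (H2.toL2_injective (h.trans (map_zero _).symm))
      exact Complex.conj_eq_iff_re.mp (mul_right_cancel₀ h4 h3)
    refine isBlochEigenpair_iff.mpr ⟨hne, fun v => ?_⟩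
    rw [hreal, hform]
  have hleast : ∀ η ∈ U, IsLeast (blochEigenvalues A ρ η) (l η) := by
    intro η hη
    refine ⟨⟨φ η, hpair η hη⟩, ?_⟩
    rintro μ ⟨ψ, hψ⟩
    by_contra! hlt
    obtain ⟨-, -, hsmall, hcl⟩ := hball η (hsub η hη)
    have hη2 : ‖η‖ ≤ 1 / 2 :=
      (mem_ball_zero_iff.mp hη).le.trans (min_le_right _ _)
    -- An eigenvalue below l would differ from it, so its eigenfunction would be orthogonal to φ and
    -- subject to the gap, whereas l itself lies below the gap.
    have horth := (hpair η hη).inner_eq_zero hA hψ hlt.ne'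
    exact absurd (hψ.le_of_inner_eq_zero hA hη2 hcl.le horth) (by linarith)
  have heq : ∀ η ∈ U, firstBlochEigenvalue A ρ η = l η := fun η hη => (hleast η hη).csInf_eq
  refine ⟨fun η hη => by rw [heq η hη]; exact hleast η hη, fun η hη => ?_, φ,
    fun η hη => (hball η (hsub η hη)).2.1, fun η hη => by rw [heq η hη]; exact hpair η hη⟩
  refine (hla η (hball η (hsub η hη)).2.1).congr ?_
  filter_upwards [Metric.isOpen_ball.mem_nhds hη] with ζ hζ
  exact (heq ζ hζ).symm

end
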